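/- **Definitions.** Let $C^n=\{-1,1\}^n$. A signed rectangle of $C^n$ is a signed set $u^+v^+u'^-v'^-$, where $u,v,u',v'\in C^n$ are the vertices of a non-degenerate rectangle of $\mathbb R^n$ with diagonals $uv$ and $u'v'$. An *oriented cube* on $C^n$ is an oriented matroid with ground set $C^n$ that has all signed rectangles among its signed circuits, and that has among its signed cocircuits the signed sets $(\{v: v_i=\varepsilon\},\emptyset)$ for $1\le i\le n$, $\varepsilon\in\{1,-1\}$, and $(\{v: v_i=1,\ v_j=-\varepsilon\},\{v: v_i=-1,\ v_j=\varepsilon\})$ for $1\le i<j\le n$, $\varepsilon\in\{1,-1\}$ (complementary to the facets and skew-facets of the cube). For $\mathbf h\in\mathbb N_0^n$ put $|\mathbf h|=\sum_i h_i$ and, for $a\in\mathbb N_0$, let $S_a(\mathbf h)=\{v\in C^n:\ \mathbf h\cdot v=|\mathbf h|-2a\}$. The vector $\mathbf h$ is *primitive* if for all integers $0\le a<b\le c<d\le|\mathbf h|$ with $a+d=b+c$ there is a signed rectangle $v_a^+v_d^+v_b^-v_c^-$ of $C^n$ with $v_x\in S_x(\mathbf h)$ for $x=a,b,c,d$. We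 write $S_a(\mathbf h)\hookrightarrow S_b(\mathbf h)$ if the complete graph on $S_a(\mathbf h)$ has a spanning tree such that for every edge $\{u,u'\}$ of it there are $v,v'\in S_b(\mathbf h)$ for which $u^+v^+u'^-v'^-$ is a signed rectangle. Finally let $X_b(\mathbf h)$ be the signed set $\bigl(\bigcup_{a<b}S_a(\mathbf h),\ \bigcup_{a>b}S_a(\mathbf h)\bigr)$. **Theorem.** Let $\mathbf h$ be a primitive vector of $C^{n-1}$ and let $b\in\mathbb N_0$ satisfy 1. $S_a(\mathbf h)\hookrightarrow S_b(\mathbf h)$ for all $a$ with $0<a<|\mathbf h|$, $a\ne b$; 2. $X_b(\mathbf h)$ is a signed cocircuit of every oriented cube on $C^{n-1}$. Then for every integer $g$ with $0\le g\le b$ the vector $\mathbf g=(\mathbf h,g)\in\mathbb N_0^n$ satisfies 1. $S_a(\mathbf g)\hookrightarrow S_b(\mathbf g)$ for all $a$ with $0<a<|\mathbf g|$, $a\ne b$; 2. $X_b(\mathbf g)$ is a signed cocircuit of every oriented cube on $C^n$. Moreover $X_b(\mathbf g)$ restricts to $X_b(\mathbf h)$ on the facet $\{(v,1): v\in C^{n-1}\}$,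 so that $X_b(\mathbf h)$ extends to a signed cocircuit of every oriented cube on $C^n$. -/

import Mathlib

/-- A signed set `(P, N)`, encoded as the sign vector that is `+` on `P`, `-` on `N`
and `0` elsewhere (`P` and `N` are disjoint in all uses below). -/
noncomputable def signedSet {E : Type*} (P N : Set E) : E → SignType :=
  open Classical in fun e => if e ∈ P then 1 else if e ∈ N then -1 else 0

/-- Composition of sign vectors: `X ∘ Y` is `X` where `X` is nonzero, and `Y` elsewhere. -/
def signComp {E : Type*} (X Y : E → SignType) : E → SignType :=
  fun e => if X e = 0 then Y e else X e

/-- Orthogonality of sign vectors: the products `X e * Y e` are all zero, or both signs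
occur among them. -/
def SignOrthogonal {E : Type*} (X Y : E → SignType) : Prop :=
  (∃ e, X e * Y e = 1) ↔ (∃ e, X e * Y e = -1)

/-- An oriented matroid on a (finite) ground set `E`, given by its covectors. -/
structure OrientedMatroid (E : Type*) [Finite E] where
  covectors : Set (E → SignType)
  zero_mem : (fun _ => 0) ∈ covectors
  neg_mem : ∀ X ∈ covectors, (fun e => -X e) ∈ covectors
  comp_mem : ∀ X ∈ covectors, ∀ Y ∈ covectors, signComp X Y ∈ covectors
  /-- Covector elimination: `e` is an element separating `X` and `Y`. -/
  elimination : ∀ X ∈ covectors, ∀ Y ∈ covectors, ∀ e, X e ≠ 0 → X e = -Y e →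
    ∃ Z ∈ covectors, Z e = 0 ∧
      ∀ f, ¬ (X f ≠ 0 ∧ X f = -Y f) → Z f = signComp X Y f

namespace OrientedMatroid

variable {E : Type*} [Finite E]

/-- The vectors of an oriented matroid: the sign vectors orthogonal to all covectors. -/
def vectors (M : OrientedMatroid E) : Set (E → SignType) :=
  {X | ∀ Y ∈ M.covectors, SignOrthogonal X Y}

/-- `X` is a nonzero member of `L` with inclusion-minimal support. -/
def IsSupportMinimal (L : Set (E → SignType)) (X : E → SignType) : Prop :=
  X ∈ L ∧ X ≠ 0 ∧
    ∀ Y ∈ L, Y ≠ 0 → Function.support Y ⊆ Function.support X →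
      Function.support Y = Function.support X

/-- Signed cocircuits: the nonzero covectors of minimal support. -/
def IsCocircuit (M : OrientedMatroid E) (X : E → SignType) : Prop :=
  IsSupportMinimal M.covectors X

/-- Signed circuits: the nonzero vectors of minimal support. -/
def IsCircuit (M : OrientedMatroid E) (X : E → SignType) : Prop :=
  IsSupportMinimal M.vectors X

end OrientedMatroid

/-- The set `C^n = {-1, 1}^n` of vertices of the cube. -/
abbrev Cube (n : ℕ) : Type := Fin n → ℤˣ

/-- `u, v, u', v'` are the four vertices of a (non-degenerate) rectangle with diagonals `uv`
and `u'v'`: a parallelogram with a right angle at `u` whose sides at `u` are not trivial. -/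
def IsRectangle {n : ℕ} (u v u' v' : Cube n) : Prop :=
  (∀ i, (u i : ℤ) + (v i : ℤ) = (u' i : ℤ) + (v' i : ℤ)) ∧
  ∑ i, ((u' i : ℤ) - (u i : ℤ)) * ((v' i : ℤ) - (u i : ℤ)) = 0 ∧
  u ≠ u' ∧ u ≠ v'

/-- The facet `H_{i^+}` (for `s = 1`) or `H_{i^-}` (for `s = -1`). -/
def facet {n : ℕ} (i : Fin n) (s : ℤˣ) : Set (Cube n) := {v | v i = s}

/-- An oriented cube: an oriented matroid on `C^n` that has the signed rectangles among its
signed circuits, and the signed sets complementary to the facets and to the skew-facets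
`v i = v j`, `v i = - v j` among its signed cocircuits. -/
structure IsOrientedCube {n : ℕ} (M : OrientedMatroid (Cube n)) : Prop where
  rectangle : ∀ u v u' v' : Cube n, IsRectangle u v u' v' →
    M.IsCircuit (signedSet {u, v} {u', v'})
  facet_pos : ∀ i : Fin n, M.IsCocircuit (signedSet (facet i (-1)) ∅)
  facet_neg : ∀ i : Fin n, M.IsCocircuit (signedSet (facet i 1) ∅)
  skew_pos : ∀ i j : Fin n, i < j →
    M.IsCocircuit (signedSet (facet i 1 ∩ facet j (-1)) (facet i (-1) ∩ facet j 1))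
  skew_neg : ∀ i j : Fin n, i < j →
    M.IsCocircuit (signedSet (facet i 1 ∩ facet j 1) (facet i (-1) ∩ facet j (-1)))

/-- `|h|`, the sum of the entries of `h`. -/
def weight {n : ℕ} (h : Fin n → ℕ) : ℕ := ∑ i, h i

/-- The `a`-level `S_a(h)`: the vertices `v` with `h · v = |h| - 2a`
(it is empty for `a > |h|`). -/
def level {n : ℕ} (h : Fin n → ℕ) (a : ℕ) : Set (Cube n) :=
  {v | ∑ i, (h i : ℤ) * (v i : ℤ) = (weight h : ℤ) - 2 * (a : ℤ)}

/-- The `h`-rectangle `(a, b, c, d)` is realizable: some signed rectangle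
`v_a⁺ v_b⁻ v_c⁻ v_d⁺` has its vertices in the respective levels. -/
def Realizable {n : ℕ} (h : Fin n → ℕ) (a b c d : ℕ) : Prop :=
  ∃ va ∈ level h a, ∃ vb ∈ level h b, ∃ vc ∈ level h c, ∃ vd ∈ level h d,
    IsRectangle va vd vb vc

/-- `h` is primitive: all its `3`-rectangles (`a < b = c < d`) and `4`-rectangles
(`a < b < c < d`), where `d = b + c - a` and `d ≤ |h|`, are realizable. -/
def IsPrimitive {n : ℕ} (h : Fin n → ℕ) : Prop :=
  ∀ a b c d : ℕ, a < b → b ≤ c → c < d → a + d = b + c → d ≤ weight h → Realizable h a b c d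

/-- `A` is embedded in `B`: the complete graph on `A` has a spanning tree each edge
`{u, u'}` of which is a side of a signed rectangle `u⁺ u'⁻ v'⁻ v⁺` with `v, v' ∈ B`. -/
def Embeds {n : ℕ} (A B : Set (Cube n)) : Prop :=
  ∃ T : SimpleGraph A, T.IsTree ∧
    ∀ u u' : A, T.Adj u u' → ∃ v ∈ B, ∃ v' ∈ B, IsRectangle (u : Cube n) v u' v'

/-- The signed set `X_b(h) = (⋃_{a < b} S_a(h), ⋃_{a > b} S_a(h))`. -/
noncomputable def levelSigned {n : ℕ} (h : Fin n → ℕ) (b : ℕ) : Cube n → SignType :=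
  signedSet (⋃ a < b, level h a) (⋃ a > b, level h a)

/-- The vector `(h, g)` obtained from `h` by appending the entry `g`. -/
def appendEntry {n : ℕ} (h : Fin n → ℕ) (g : ℕ) : Fin (n + 1) → ℕ :=
  Fin.snoc (α := fun _ => ℕ) h g

/-!
Two facts about a covector `W` of an oriented cube carry the proof. Orthogonality to the signed
rectangles means that if `W` vanishes on one side of a rectangle, then it has equal signs at the ends
of the opposite side (`BalancedSigns.eq_of_zero`). Hence, if `W` vanishes on the `b`-level and the
`a`-level is embedded in the `b`-level, then `W` is constant on the `a`-level. Here embeddings are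
replaced by the connectedness of `sideGraph`, which is the same by `embeds_iff`.

Embeddings (`LevelsLinked.appendEntry`). The `a`-level of `(h, g)` consists of a copy of the `a`-level
of `h` and of a copy, in the opposite facet, of its `(a - g)`-level. Both are linked to the `b`-level
of `(h, g)` through the copy of the `b`-level of `h` in the facet of last coordinate `1`, and a
rectangle of `h` with heights `a`, `b - g` on one diagonal and `a - g`, `b` on the other, available
because `h` is primitive, joins the two copies. When `g = 0` a rectangle in the last direction does.

Cocircuits (`isCocircuit_levelSigned_appendEntry`). The facet of last coordinate `1` of an oriented
cube is again an oriented cube, so `X_b(h)` extends to a covector. The complement of this facet is a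
cocircuit, and eliminating with it gives an extension that also vanishes at a vertex `p` of the
`b`-level outside the facet. Such an extension is unique, and equal to `X_b(h, g)`
(`eq_levelSigned_appendEntry`): rectangles propagate the zero from `p` to the whole `b`-level, so that
the signs are constant on the levels; levels of height at most `|h|` meet the facet, where the signs
are known, and the higher levels are negative by induction along rectangles. Uniqueness also gives the
minimality of the support.

The inequality `b ≤ |h|`, needed for both parts, comes from the second hypothesis, which presupposes
that oriented cubes exist: the signs of the affine functions form one
(`isOrientedCube_rectangleAffine`).
-/

/-! ### Heights and levels -/

/-- The height of a vertex: the total weight of its negative coordinates. The `a`-level of `h`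
consists of the vertices of height `a`. -/
def height {n : ℕ} (h : Fin n → ℕ) (v : Cube n) : ℕ := ∑ i, if v i = 1 then 0 else h i

lemma mem_level {n : ℕ} {h : Fin n → ℕ} {a : ℕ} {v : Cube n} :
    v ∈ level h a ↔ height h v = a := by
  have key : ∑ i, (h i : ℤ) * (v i : ℤ) = (weight h : ℤ) - 2 * (height h v : ℤ) := by
    simp only [weight, height]
    push_cast
    rw [Finset.mul_sum, ← Finset.sum_sub_distrib]
    refine Finset.sum_congr rfl fun i _ => ?_
    rcases Int.units_eq_one_or (v i) with hv | hv <;> simp [hv]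
    ring
  simp only [level, Set.mem_ofPred_eq, key]
  omega

lemma levelSigned_apply {n : ℕ} (h : Fin n → ℕ) (b : ℕ) (v : Cube n) :
    levelSigned h b v = SignType.sign ((b : ℤ) - height h v) := by
  rcases lt_trichotomy (height h v) b with hv | hv | hv
  · rw [sign_pos (by omega)]
    simp [levelSigned, signedSet, mem_level, hv]
  · rw [hv, sub_self, sign_zero]
    simp [levelSigned, signedSet, mem_level, hv]
  · rw [sign_neg (by omega)]
    simp [levelSigned, signedSet, mem_level, hv, hv.le]

lemma height_le_weight {n : ℕ} (h : Fin n → ℕ) (v : Cube n) : height h v ≤ weight h :=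
  Finset.sum_le_sum fun i _ => by split_ifs <;> simp

/-- The vertex of the `(n + 1)`-cube with first coordinates `v` and last coordinate `s`. -/
abbrev Cube.snoc {n : ℕ} (v : Cube n) (s : ℤˣ) : Cube (n + 1) :=
  Fin.snoc (α := fun _ => ℤˣ) v s

lemma Cube.exists_snoc {n : ℕ} (w : Cube (n + 1)) : ∃ v s, w = Cube.snoc v s :=
  ⟨Fin.init w, w (Fin.last n), (Fin.snoc_init_self w).symm⟩

lemma Cube.snoc_injective {n : ℕ} (s : ℤˣ) :
    Function.Injective fun v : Cube n => Cube.snoc v s :=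
  fun u v huv => by simpa [Cube.snoc] using congrArg Fin.init huv

lemma height_snoc {n : ℕ} (h : Fin n → ℕ) (g : ℕ) (v : Cube n) (s : ℤˣ) :
    height (appendEntry h g) (v.snoc s) = height h v + if s = 1 then 0 else g := by
  simp [height, appendEntry, Cube.snoc, Fin.sum_univ_castSucc]

lemma height_snoc_one {n : ℕ} (h : Fin n → ℕ) (g : ℕ) (v : Cube n) :
    height (appendEntry h g) (v.snoc 1) = height h v := by
  simp [height_snoc]

lemma height_snoc_neg_one {n : ℕ} (h : Fin n → ℕ) (g : ℕ) (v : Cube n) :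
    height (appendEntry h g) (v.snoc (-1)) = height h v + g := by
  rw [height_snoc, if_neg (by decide)]

lemma weight_appendEntry {n : ℕ} (h : Fin n → ℕ) (g : ℕ) :
    weight (appendEntry h g) = weight h + g := by
  simp [weight, appendEntry, Fin.sum_univ_castSucc]

/-! ### Rectangles of the cube -/

/-- Every parallelogram of the cube is a rectangle, and in each coordinate it is constant along
one of its two directions. -/
lemma isRectangle_iff {n : ℕ} {u v u' v' : Cube n} :
    IsRectangle u v u' v' ↔
      (∀ i, (u' i = u i ∧ v i = v' i) ∨ (v' i = u i ∧ v i = u' i)) ∧ u ≠ u' ∧ u ≠ v' := by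
  have aux : ∀ a b c d : ℤˣ, (a : ℤ) + b = c + d → (c = a ∧ b = d) ∨ (d = a ∧ b = c) := by
    decide
  constructor
  · rintro ⟨h1, -, h3, h4⟩
    exact ⟨fun i => aux _ _ _ _ (h1 i), h3, h4⟩
  · rintro ⟨h1, h3, h4⟩
    refine ⟨fun i => ?_, Finset.sum_eq_zero fun i _ => ?_, h3, h4⟩
    · rcases h1 i with ⟨h, h'⟩ | ⟨h, h'⟩ <;> rw [h, h']
      ring
    · rcases h1 i with ⟨h, h'⟩ | ⟨h, h'⟩ <;> simp [h]

namespace IsRectangle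

variable {n : ℕ} {u v u' v' : Cube n}

lemma swap_right (H : IsRectangle u v u' v') : IsRectangle u v v' u' := by
  rw [isRectangle_iff] at H ⊢
  exact ⟨fun i => (H.1 i).symm, H.2.2, H.2.1⟩

lemma ne_right (H : IsRectangle u v u' v') : v ≠ u' := by
  rintro rfl
  rw [isRectangle_iff] at H
  refine H.2.2 (funext fun i => ?_)
  rcases H.1 i with h | h
  · exact h.1.symm.trans h.2
  · exact h.1.symm

lemma exchange (H : IsRectangle u v u' v') : IsRectangle u' v' u v := by
  have hne := H.ne_right
  rw [isRectangle_iff] at H ⊢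
  refine ⟨fun i => ?_, H.2.1.symm, hne.symm⟩
  rcases H.1 i with h | h
  · exact Or.inl ⟨h.1.symm, h.2.symm⟩
  · exact Or.inr ⟨h.2, h.1⟩

/-- A rectangle lifts to the next cube when the new coordinates are constant along one of the
directions. -/
lemma snoc (H : IsRectangle u v u' v') {s t s' t' : ℤˣ}
    (hst : (s' = s ∧ t = t') ∨ (t' = s ∧ t = s')) :
    IsRectangle (u.snoc s) (v.snoc t) (u'.snoc s') (v'.snoc t') := by
  rw [isRectangle_iff] at H ⊢
  refine ⟨fun i => ?_, fun h => H.2.1 ?_, fun h => H.2.2 ?_⟩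
  · refine Fin.lastCases ?_ (fun j => ?_) i
    · simpa [Cube.snoc] using hst
    · simpa [Cube.snoc] using H.1 j
  · simpa [Cube.snoc] using congrArg Fin.init h
  · simpa [Cube.snoc] using congrArg Fin.init h

end IsRectangle

/-- The rectangle over the pair `u`, `v` in the direction of the `i`-th axis. -/
lemma isRectangle_update {n : ℕ} {u v : Cube n} {i : Fin n} {s : ℤˣ} (huv : u ≠ v)
    (hi : u i = v i) (hs : s ≠ u i) :
    IsRectangle u (Function.update v i s) v (Function.update u i s) := by
  rw [isRectangle_iff]
  refine ⟨fun k => ?_, huv, fun h => hs ?_⟩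
  · by_cases hk : k = i
    · subst hk
      simp [hi]
    · simp [hk]
  · simpa using (congrFun h i).symm

/-- The rectangle over the pair `u`, `v` in the direction of the last axis. -/
lemma isRectangle_prism {n : ℕ} {u v : Cube n} (huv : u ≠ v) {s t : ℤˣ} (hst : s ≠ t) :
    IsRectangle (u.snoc s) (v.snoc t) (v.snoc s) (u.snoc t) := by
  rw [isRectangle_iff]
  refine ⟨fun i => ?_, fun h => huv (Cube.snoc_injective s h), fun h => hst ?_⟩
  · refine Fin.lastCases ?_ (fun j => ?_) i <;> simp [Cube.snoc]
  · simpa [Cube.snoc] using congrFun h (Fin.last n)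

/-! ### Levels of primitive vectors -/

lemma IsPrimitive.exists_height_eq {n : ℕ} {h : Fin n → ℕ} (hprim : IsPrimitive h) {a : ℕ}
    (ha : a ≤ weight h) : ∃ v, height h v = a := by
  rcases Nat.eq_zero_or_pos a with rfl | h0
  · exact ⟨fun _ => 1, by simp [height]⟩
  rcases ha.eq_or_lt with rfl | h1
  · exact ⟨fun _ => -1, by simp [height, weight, show (-1 : ℤˣ) ≠ 1 by decide]⟩
  by_cases h2 : 2 * a ≤ weight h
  · obtain ⟨_, -, v, hv, -⟩ := hprim 0 a a (2 * a) h0 le_rfl (by omega) (by omega) h2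
    exact ⟨v, mem_level.1 hv⟩
  · obtain ⟨_, -, v, hv, -⟩ :=
      hprim (2 * a - weight h) a a (weight h) (by omega) le_rfl h1 (by omega) le_rfl
    exact ⟨v, mem_level.1 hv⟩

/-- The rectangles realizing the `h`-rectangles, described by the heights `p`, `p + δ` and `q`,
`q + δ` of two parallel sides, in whichever order these four heights come. -/
lemma IsPrimitive.exists_isRectangle {n : ℕ} {h : Fin n → ℕ} (hprim : IsPrimitive h)
    {p q δ : ℕ} (hδ : 0 < δ) (hpq : p ≠ q) (hp : p + δ ≤ weight h) (hq : q + δ ≤ weight h) :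
    ∃ x y z d, height h x = p ∧ height h y = p + δ ∧ height h z = q ∧ height h d = q + δ ∧
      IsRectangle x d y z := by
  wlog hlt : p < q generalizing p q
  · obtain ⟨x, y, z, d, hx, hy, hz, hd, H⟩ := this hpq.symm hq hp (by omega)
    exact ⟨z, d, x, y, hz, hd, hx, hy, H.swap_right.exchange.swap_right⟩
  rcases le_or_gt (p + δ) q with hle | hle
  · obtain ⟨x, hx, y, hy, z, hz, d, hd, H⟩ :=
      hprim p (p + δ) q (q + δ) (by omega) hle (by omega) (by omega) hq
    exact ⟨x, y, z, d, mem_level.1 hx, mem_level.1 hy, mem_level.1 hz, mem_level.1 hd, H⟩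
  · obtain ⟨x, hx, z, hz, y, hy, d, hd, H⟩ :=
      hprim p q (p + δ) (q + δ) (by omega) (by omega) (by omega) (by omega) hq
    exact ⟨x, y, z, d, mem_level.1 hx, mem_level.1 hy, mem_level.1 hz, mem_level.1 hd,
      H.swap_right⟩

/-! ### Embeddings of levels -/

/-- The graph on `A` whose edges are the sides of rectangles with opposite side in `B`. -/
def sideGraph {n : ℕ} (A B : Set (Cube n)) : SimpleGraph A where
  Adj u u' := ∃ v ∈ B, ∃ v' ∈ B, IsRectangle (u : Cube n) v u' v'
  symm := ⟨fun _ _ ⟨v, hv, v', hv', H⟩ => ⟨v', hv', v, hv, H.exchange⟩⟩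
  loopless := ⟨fun _ ⟨_, _, _, _, H⟩ => H.2.2.1 rfl⟩

lemma embeds_iff {n : ℕ} {A B : Set (Cube n)} : Embeds A B ↔ (sideGraph A B).Connected := by
  constructor
  · rintro ⟨T, hT, hadj⟩
    exact hT.connected.mono fun u u' => hadj u u'
  · intro hc
    obtain ⟨T, hle, hT⟩ := hc.exists_isTree_le
    exact ⟨T, hT, fun u u' huu' => hle huu'⟩

lemma eq_of_sideGraph_reachable {n : ℕ} {A B : Set (Cube n)} {α : Type*} {f : Cube n → α}
    (hf : ∀ u v u' v', IsRectangle u v u' v' → v ∈ B → v' ∈ B → f u = f u') {u u' : A}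
    (huu' : (sideGraph A B).Reachable u u') : f u = f u' := by
  rw [SimpleGraph.reachable_iff_reflTransGen] at huu'
  induction huu' with
  | refl => rfl
  | tail _ hadj ih =>
    obtain ⟨v, hv, v', hv', H⟩ := hadj
    exact ih.trans (hf _ _ _ _ H hv hv')

/-- Every level other than the `b`-level is connected by sides of rectangles with opposite side
in the `b`-level. Unlike in the hypotheses of the theorem, the extreme levels are included. -/
def LevelsLinked {n : ℕ} (h : Fin n → ℕ) (b : ℕ) : Prop :=
  ∀ a, a ≠ b → (sideGraph (level h a) (level h b)).Preconnected

/-- Two vertices that differ only where `h` vanishes are joined by a side of a rectangle whose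
other side lies in any prescribed different level. -/
lemma sideGraph_adj_of_agree {n : ℕ} {h : Fin n → ℕ} {a b : ℕ} (hab : a ≠ b) {w : Cube n}
    (hw : height h w = b) {u u' : level h a} (hne : u ≠ u')
    (hag : ∀ i, (u : Cube n) i = (u' : Cube n) i ∨ h i = 0) :
    (sideGraph (level h a) (level h b)).Adj u u' := by
  have hmix : ∀ x : Cube n, height h (fun i => if h i = 0 then x i else w i) = b := by
    intro x
    rw [← hw]
    refine Finset.sum_congr rfl fun i _ => ?_
    by_cases hi : h i = 0 <;> simp [hi]
  refine ⟨_, mem_level.2 (hmix u'), _, mem_level.2 (hmix u), ?_⟩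
  rw [isRectangle_iff]
  refine ⟨fun i => ?_, fun h => hne (Subtype.ext h), fun h => hab ?_⟩
  · by_cases hi : h i = 0
    · simp [hi]
    · simp [hi, (hag i).resolve_right hi]
  · rw [← hmix u, ← h, mem_level.1 u.2]

lemma levelsLinked_of_embeds {n : ℕ} {h : Fin n → ℕ} (hprim : IsPrimitive h) {b : ℕ}
    (hb : b ≤ weight h)
    (hembed : ∀ a : ℕ, 0 < a → a < weight h → a ≠ b → Embeds (level h a) (level h b)) :
    LevelsLinked h b := by
  intro a hab
  by_cases ha : 0 < a ∧ a < weight h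
  · exact (embeds_iff.1 (hembed a ha.1 ha.2 hab)).preconnected
  intro u u'
  by_cases hne : u = u'
  · rw [hne]
  obtain ⟨w, hw⟩ := hprim.exists_height_eq hb
  have hu := mem_level.1 u.2
  have hu' := mem_level.1 u'.2
  refine (sideGraph_adj_of_agree hab hw hne fun i => ?_).reachable
  rcases Nat.eq_zero_or_pos a with rfl | h0
  · simp only [height, Finset.sum_eq_zero_iff, Finset.mem_univ, true_imp_iff] at hu hu'
    have h1 := hu i
    have h2 := hu' i
    by_cases hi : h i = 0
    · exact Or.inr hi
    · simp [hi] at h1 h2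
      exact Or.inl (h1.trans h2.symm)
  · have hle := height_le_weight h (u : Cube n)
    have haw : a = weight h := by omega
    -- In the top level all coordinates of nonzero weight are negative.
    have top : ∀ x : Cube n, height h x = a → h i ≠ 0 → x i = -1 := by
      intro x hx hi
      by_contra hxi
      have hx1 : x i = 1 := (Int.units_eq_one_or _).resolve_right hxi
      have : height h x < weight h :=
        Finset.sum_lt_sum (fun j _ => by split_ifs <;> simp)
          ⟨i, Finset.mem_univ i, by simp [hx1]; omega⟩
      omega
    by_cases hi : h i = 0
    · exact Or.inr hi
    · exact Or.inl ((top _ hu hi).trans (top _ hu' hi).symm)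

lemma LevelsLinked.appendEntry {n : ℕ} {h : Fin n → ℕ} {b : ℕ} (hlink : LevelsLinked h b)
    (hprim : IsPrimitive h) (hb : b ≤ weight h) {g : ℕ} (hg : g ≤ b) :
    LevelsLinked (appendEntry h g) b := by
  intro a hab
  have reach_pos : ∀ (u u' : level (_root_.appendEntry h g) a) (x x' : Cube n),
      (u : Cube (n + 1)) = x.snoc 1 → (u' : Cube (n + 1)) = x'.snoc 1 →
      (sideGraph (level (_root_.appendEntry h g) a) (level (_root_.appendEntry h g) b)).Reachable
        u u' := by
    rintro ⟨_, hu⟩ ⟨_, hu'⟩ x x' rfl rfl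
    let F : sideGraph (level h a) (level h b) →g
        sideGraph (level (_root_.appendEntry h g) a) (level (_root_.appendEntry h g) b) :=
      { toFun := fun y => ⟨Cube.snoc y 1, mem_level.2 (by
          rw [height_snoc_one]; exact mem_level.1 y.2)⟩
        map_rel' := by
          rintro y y' ⟨v, hv, v', hv', H⟩
          exact ⟨v.snoc 1, mem_level.2 (by rw [height_snoc_one]; exact mem_level.1 hv),
            v'.snoc 1, mem_level.2 (by rw [height_snoc_one]; exact mem_level.1 hv'),
            H.snoc (Or.inl ⟨rfl, rfl⟩)⟩ }
    rw [mem_level, height_snoc_one] at hu hu'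
    exact (hlink a hab ⟨x, mem_level.2 hu⟩ ⟨x', mem_level.2 hu'⟩).map F
  have reach_neg : ∀ (u u' : level (_root_.appendEntry h g) a) (x x' : Cube n),
      (u : Cube (n + 1)) = x.snoc (-1) → (u' : Cube (n + 1)) = x'.snoc (-1) →
      (sideGraph (level (_root_.appendEntry h g) a) (level (_root_.appendEntry h g) b)).Reachable
        u u' := by
    rintro ⟨_, hu⟩ ⟨_, hu'⟩ x x' rfl rfl
    rw [mem_level, height_snoc_neg_one] at hu hu'
    by_cases hxb : height h x = b
    · -- Both vertices lie over the `b`-level of `h`, so the last direction gives a rectangle.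
      by_cases hxx : x = x'
      · subst hxx; rfl
      · refine SimpleGraph.Adj.reachable ⟨x'.snoc 1, mem_level.2 ?_, x.snoc 1, mem_level.2 ?_,
          isRectangle_prism hxx (by decide)⟩
        · rw [height_snoc_one]; omega
        · rw [height_snoc_one]; omega
    · let F : sideGraph (level h (height h x)) (level h b) →g
          sideGraph (level (_root_.appendEntry h g) a) (level (_root_.appendEntry h g) b) :=
        { toFun := fun y => ⟨Cube.snoc y (-1), mem_level.2 (by
            rw [height_snoc_neg_one, mem_level.1 y.2]; exact hu)⟩
          map_rel' := by
            rintro y y' ⟨v, hv, v', hv', H⟩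
            exact ⟨v.snoc 1, mem_level.2 (by rw [height_snoc_one]; exact mem_level.1 hv),
              v'.snoc 1, mem_level.2 (by rw [height_snoc_one]; exact mem_level.1 hv'),
              H.snoc (Or.inl ⟨rfl, rfl⟩)⟩ }
      exact (hlink _ hxb ⟨x, mem_level.2 rfl⟩ ⟨x', mem_level.2 (by omega)⟩).map F
  have bridge : ∀ (u u' : level (_root_.appendEntry h g) a) (x x' : Cube n),
      (u : Cube (n + 1)) = x.snoc 1 → (u' : Cube (n + 1)) = x'.snoc (-1) →
      (sideGraph (level (_root_.appendEntry h g) a) (level (_root_.appendEntry h g) b)).Reachable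
        u u' := by
    intro u u' x x' hux hux'
    have hxa : height h x = a := by
      rw [← mem_level.1 u.2, hux, height_snoc_one]
    have hxa' : height h x' + g = a := by
      rw [← mem_level.1 u'.2, hux', height_snoc_neg_one]
    have hxw := height_le_weight h x
    rcases Nat.eq_zero_or_pos g with rfl | h0
    · obtain ⟨w, hw⟩ := hprim.exists_height_eq hb
      have hne : x ≠ w := by
        rintro rfl
        omega
      have hm : x.snoc (-1) ∈ level (_root_.appendEntry h 0) a :=
        mem_level.2 (by rw [height_snoc_neg_one]; omega)
      have hadj : (sideGraph (level (_root_.appendEntry h 0) a)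
          (level (_root_.appendEntry h 0) b)).Adj u ⟨_, hm⟩ := by
        refine ⟨w.snoc (-1), mem_level.2 ?_, w.snoc 1, mem_level.2 ?_, ?_⟩
        · rw [height_snoc_neg_one]; omega
        · rw [height_snoc_one]; omega
        · rw [hux]
          exact (isRectangle_prism hne (by decide)).swap_right
      exact hadj.reachable.trans (reach_neg _ _ _ _ rfl hux')
    · obtain ⟨y, z, q, d, hy, hz, hq, hd, H⟩ :=
        hprim.exists_isRectangle (p := a - g) (q := b - g) h0 (by omega) (by omega) (by omega)
      have hm1 : y.snoc (-1) ∈ level (_root_.appendEntry h g) a :=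
        mem_level.2 (by rw [height_snoc_neg_one]; omega)
      have hm2 : z.snoc 1 ∈ level (_root_.appendEntry h g) a :=
        mem_level.2 (by rw [height_snoc_one]; omega)
      have hadj : (sideGraph (level (_root_.appendEntry h g) a)
          (level (_root_.appendEntry h g) b)).Adj ⟨_, hm1⟩ ⟨_, hm2⟩ := by
        refine ⟨d.snoc 1, mem_level.2 ?_, q.snoc (-1), mem_level.2 ?_,
          H.snoc (Or.inr ⟨rfl, rfl⟩)⟩
        · rw [height_snoc_one]; omega
        · rw [height_snoc_neg_one]; omega
      exact ((reach_pos _ _ _ _ hux rfl).trans hadj.reachable.symm).trans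
        (reach_neg _ _ _ _ rfl hux')
  intro u u'
  obtain ⟨x, s, hx⟩ := Cube.exists_snoc (u : Cube (n + 1))
  obtain ⟨x', s', hx'⟩ := Cube.exists_snoc (u' : Cube (n + 1))
  rcases Int.units_eq_one_or s with rfl | rfl <;> rcases Int.units_eq_one_or s' with rfl | rfl
  · exact reach_pos _ _ _ _ hx hx'
  · exact bridge _ _ _ _ hx hx'
  · exact (bridge _ _ _ _ hx' hx).symm
  · exact reach_neg _ _ _ _ hx hx'

/-! ### Signed sets and orthogonality -/

/-- Four signs, at the vertices of a rectangle listed diagonal by diagonal, are balanced if they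
are orthogonal to the signs `+`, `+`, `-`, `-` of the signed rectangle. -/
def BalancedSigns (p q r s : SignType) : Prop :=
  (p = 1 ∨ q = 1 ∨ r = -1 ∨ s = -1) ↔ (p = -1 ∨ q = -1 ∨ r = 1 ∨ s = 1)

instance (p q r s : SignType) : Decidable (BalancedSigns p q r s) :=
  inferInstanceAs (Decidable (_ ↔ _))

lemma BalancedSigns.eq_of_zero {p q r s : SignType} (hb : BalancedSigns p q r s)
    (hq : q = 0) (hs : s = 0) :
    p = r := by
  revert p q r s
  decide

lemma signedSet_ne_zero_iff {E : Type*} {P N : Set E} {e : E} :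
    signedSet P N e ≠ 0 ↔ e ∈ P ∨ e ∈ N := by
  unfold signedSet
  split_ifs <;> simp [*]

lemma support_signedSet {E : Type*} (P N : Set E) :
    Function.support (signedSet P N) = P ∪ N := by
  ext e
  exact signedSet_ne_zero_iff

lemma signOrthogonal_signedSet_iff {E : Type*} {P N : Set E} (hPN : Disjoint P N)
    (Y : E → SignType) :
    SignOrthogonal (signedSet P N) Y ↔
      (((∃ e ∈ P, Y e = 1) ∨ ∃ e ∈ N, Y e = -1) ↔
        ((∃ e ∈ P, Y e = -1) ∨ ∃ e ∈ N, Y e = 1)) := by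
  have aux : ∀ s t : SignType, -s = t ↔ s = -t := by decide
  have key : ∀ σ : SignType, σ ≠ 0 → ((∃ e, signedSet P N e * Y e = σ) ↔
      ((∃ e ∈ P, Y e = σ) ∨ ∃ e ∈ N, Y e = -σ)) := by
    intro σ hσ
    constructor
    · rintro ⟨e, he⟩
      by_cases h1 : e ∈ P
      · exact Or.inl ⟨e, h1, by simpa [signedSet, h1] using he⟩
      by_cases h2 : e ∈ N
      · exact Or.inr ⟨e, h2, by simpa [signedSet, h1, h2, aux] using he⟩
      · exact absurd (by simpa [signedSet, h1, h2] using he.symm) hσ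
    · rintro (⟨e, he, hY⟩ | ⟨e, he, hY⟩)
      · exact ⟨e, by simp [signedSet, he, hY]⟩
      · exact ⟨e, by simp [signedSet, he, Set.disjoint_right.1 hPN he, hY]⟩
  rw [SignOrthogonal, key 1 (by decide), key (-1) (by decide), neg_neg]

lemma IsRectangle.signOrthogonal_iff {n : ℕ} {u v u' v' : Cube n} (H : IsRectangle u v u' v')
    (Y : Cube n → SignType) :
    SignOrthogonal (signedSet {u, v} {u', v'}) Y ↔ BalancedSigns (Y u) (Y v) (Y u') (Y v') := by
  rw [signOrthogonal_signedSet_iff]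
  · simp [BalancedSigns, or_assoc]
  · have h1 := H.ne_right
    have h2 := H.swap_right.ne_right
    have h3 := H.2.2.1
    have h4 := H.2.2.2
    simp [h1.symm, h2.symm, h3.symm, h4.symm]

/-! ### Oriented cubes -/

namespace OrientedMatroid

/-- The covectors of `M` are balanced on all rectangles: the signed rectangles are vectors. -/
def RectangleBalanced {n : ℕ} (M : OrientedMatroid (Cube n)) : Prop :=
  ∀ W ∈ M.covectors, ∀ u v u' v', IsRectangle u v u' v' → BalancedSigns (W u) (W v) (W u') (W v')

lemma RectangleBalanced.isCocircuit_facet {n : ℕ} {M : OrientedMatroid (Cube n)}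
    (hM : M.RectangleBalanced) {i : Fin n} {s : ℤˣ}
    (hmem : signedSet (facet i s) ∅ ∈ M.covectors) : M.IsCocircuit (signedSet (facet i s) ∅) := by
  refine ⟨hmem, fun h0 => ?_, fun W hW hW0 hsub => hsub.antisymm fun u hu => ?_⟩
  · have : signedSet (facet i s) ∅ (fun _ => s) ≠ 0 := signedSet_ne_zero_iff.2 (Or.inl rfl)
    exact this (congrFun h0 _)
  · rw [support_signedSet, Set.union_empty] at hsub hu
    obtain ⟨w, hw⟩ := Function.ne_iff.1 hW0
    have hwi : w i = s := hsub hw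
    have hui : u i = s := hu
    by_cases huw : u = w
    · rwa [huw]
    have hs : -s ≠ s := by
      rcases Int.units_eq_one_or s with rfl | rfl <;> decide
    have hzero : ∀ x, W (Function.update x i (-s)) = 0 := fun x => by
      by_contra hx
      exact hs (by simpa [facet] using hsub hx)
    have := (hM W hW _ _ _ _ (isRectangle_update huw (hui.trans hwi.symm)
      (by rwa [hui]))).eq_of_zero (hzero _) (hzero _)
    exact fun h => hw (this ▸ h)

/-- Skew-facets are treated uniformly: `c = 1` stands for `x i = x j`, and `c = -1` for
`x i = -x j`. -/
lemma RectangleBalanced.isCocircuit_skew {n : ℕ} {M : OrientedMatroid (Cube n)}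
    (hM : M.RectangleBalanced) {i j : Fin n} (hij : i ≠ j) {c : ℤˣ} {P N : Set (Cube n)}
    (hPN : P ∪ N = {v | v i * v j = c}) (hmem : signedSet P N ∈ M.covectors) :
    M.IsCocircuit (signedSet P N) := by
  have hneg : ∀ s : ℤˣ, -s ≠ s := by decide
  refine ⟨hmem, fun h0 => ?_, fun W hW hW0 hsub => hsub.antisymm fun u hu => ?_⟩
  · have hv : (fun k => if k = i then c else 1 : Cube n) ∈ P ∪ N := by
      simp [hPN, hij.symm]
    exact signedSet_ne_zero_iff.2 hv (congrFun h0 _)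
  · rw [support_signedSet, hPN] at hsub hu
    have hzero : ∀ x : Cube n, x i * x j ≠ c → W x = 0 := fun x hx => by
      by_contra hWx
      exact hx (hsub hWx)
    have hflip : ∀ x : Cube n, x i * x j = c → ∀ y, y = Function.update x i (-x i) →
        y i * y j ≠ c := by
      rintro x hx y rfl
      simp [hij.symm, hx]
    have same : ∀ x y : Cube n, x i * x j = c → y i * y j = c → x i = y i → W x ≠ 0 →
        W y ≠ 0 := by
      intro x y hx hy hxy hWx
      by_cases hne : x = y
      · rwa [← hne]
      have H := isRectangle_update hne hxy (hneg _)
      have := (hM W hW _ _ _ _ H).eq_of_zero (hzero _ (hflip y hy _ (by rw [hxy])))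
        (hzero _ (hflip x hx _ rfl))
      rwa [← this]
    obtain ⟨w, hw⟩ := Function.ne_iff.1 hW0
    have hwc : w i * w j = c := hsub hw
    by_cases hwu : w i = u i
    · exact same w u hwc hu hwu hw
    -- Reversing both coordinates of `w` reverses its sign, by a rectangle in the plane of `i`, `j`.
    set w' : Cube n := Function.update (Function.update w i (-w i)) j (-w j) with hw'
    have H : IsRectangle w w' (Function.update w i (-w i)) (Function.update w j (-w j)) := by
      rw [isRectangle_iff]
      refine ⟨fun k => ?_, fun h => ?_, fun h => ?_⟩
      · by_cases hki : k = i
        · subst hki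
          simp [hw', hij]
        · simp [hw', hki, Function.update_apply]
      · exact hneg (w i) (by simpa using (congrFun h i).symm)
      · exact hneg (w j) (by simpa using (congrFun h j).symm)
    have hb := hM W hW _ _ _ _ H
    rw [hzero _ (hflip w hwc _ rfl), hzero (Function.update w j (-w j))
      (by simp [hij, hwc])] at hb
    have hw0 : W w' ≠ 0 := by
      have aux : ∀ p q : SignType, BalancedSigns p q 0 0 → p ≠ 0 → q ≠ 0 := by decide
      exact aux _ _ hb hw
    refine same w' u (by simp [hw', hij, hwc]) hu ?_ hw0
    have : ∀ a b : ℤˣ, a ≠ b → -a = b := by decide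
    simp [hw', hij, this _ _ hwu]

lemma RectangleBalanced.mem_vectors {n : ℕ} {M : OrientedMatroid (Cube n)}
    (hM : M.RectangleBalanced) {u v u' v' : Cube n} (H : IsRectangle u v u' v') :
    signedSet {u, v} {u', v'} ∈ M.vectors :=
  fun W hW => (H.signOrthogonal_iff W).2 (hM W hW _ _ _ _ H)

/-- The facet covectors separate each side of a rectangle from the opposite side, so that the
support of a vector inside the rectangle passes from any vertex to its neighbours. -/
lemma RectangleBalanced.isCircuit_rectangle {n : ℕ} {M : OrientedMatroid (Cube n)}
    (hM : M.RectangleBalanced) (hfacet : ∀ i s, signedSet (facet i s) ∅ ∈ M.covectors)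
    {u v u' v' : Cube n} (H : IsRectangle u v u' v') :
    M.IsCircuit (signedSet {u, v} {u', v'}) := by
  refine ⟨hM.mem_vectors H, fun h0 => ?_, fun V hV hV0 hsub => hsub.antisymm ?_⟩
  · have : signedSet {u, v} {u', v'} u ≠ 0 := signedSet_ne_zero_iff.2 (Or.inl (Or.inl rfl))
    exact this (congrFun h0 _)
  rw [support_signedSet] at hsub ⊢
  have step : ∀ x y z t : Cube n, (∀ e, V e ≠ 0 → e = x ∨ e = y ∨ e = z ∨ e = t) →
      ∀ i, x i ≠ z i → x i ≠ t i → V x ≠ 0 → x i = y i → V y ≠ 0 := by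
    intro x y z t hV4 i hz ht hx hxy hy
    have horth := hV _ (hfacet i (x i))
    have hmul : ∀ e, e ≠ x → V e * signedSet (facet i (x i)) ∅ e = 0 := by
      intro e he
      by_contra hne
      rcases hV4 e (left_ne_zero_of_mul hne) with rfl | rfl | rfl | rfl
      · exact he rfl
      · exact hne (by rw [hy, zero_mul])
      · exact (signedSet_ne_zero_iff.1 (right_ne_zero_of_mul hne)).elim (fun h => hz h.symm)
          fun h => h
      · exact (signedSet_ne_zero_iff.1 (right_ne_zero_of_mul hne)).elim (fun h => ht h.symm)
          fun h => h
    have hx1 : signedSet (facet i (x i)) ∅ x = 1 := by simp [signedSet, facet]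
    have only : ∀ σ : SignType, σ ≠ 0 →
        ((∃ e, V e * signedSet (facet i (x i)) ∅ e = σ) ↔ V x = σ) := by
      intro σ hσ
      constructor
      · rintro ⟨e, he⟩
        by_cases hex : e = x
        · rwa [hex, hx1, mul_one] at he
        · exact absurd ((hmul e hex).symm.trans he).symm hσ
      · exact fun h => ⟨x, by rw [hx1, mul_one, h]⟩
    rw [SignOrthogonal, only 1 (by decide), only (-1) (by decide)] at horth
    have aux : ∀ p : SignType, (p = 1 ↔ p = -1) → p = 0 := by decide
    exact hx (aux _ horth)
  have h4 : ∀ e, V e ≠ 0 → e = u ∨ e = v ∨ e = u' ∨ e = v' := fun e he => by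
    rcases hsub he with (h | h) | (h | h)
    exacts [Or.inl h, Or.inr (Or.inl h), Or.inr (Or.inr (Or.inl h)), Or.inr (Or.inr (Or.inr h))]
  have hR := isRectangle_iff.1 H
  obtain ⟨i, hi⟩ := Function.ne_iff.1 hR.2.1
  obtain ⟨j, hj⟩ := Function.ne_iff.1 hR.2.2
  obtain ⟨hi1, hi2⟩ := (hR.1 i).resolve_left fun h => hi h.1.symm
  obtain ⟨hj1, hj2⟩ := (hR.1 j).resolve_right fun h => hj h.1.symm
  have s1 : V u ≠ 0 → V u' ≠ 0 := fun h => step u u' v v' (fun e he => by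
    have := h4 e he; tauto) j (by rwa [hj2]) hj h hj1.symm
  have s2 : V u' ≠ 0 → V v ≠ 0 := fun h => step u' v u v' (fun e he => by
    have := h4 e he; tauto) i hi.symm (by rw [hi1]; exact hi.symm) h hi2.symm
  have s3 : V v ≠ 0 → V v' ≠ 0 := fun h => step v v' u u' (fun e he => by
    have := h4 e he; tauto) j (by rw [hj2]; exact hj.symm) (by rw [hj2, hj1]; exact hj.symm) h hj2
  have s4 : V v' ≠ 0 → V u ≠ 0 := fun h => step v' u v u' (fun e he => by
    have := h4 e he; tauto) i (by rw [hi1, hi2]; exact hi) (by rwa [hi1]) h hi1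
  obtain ⟨e, he⟩ := Function.ne_iff.1 hV0
  have hall : V u ≠ 0 ∧ V v ≠ 0 ∧ V u' ≠ 0 ∧ V v' ≠ 0 := by
    rcases h4 e he with rfl | rfl | rfl | rfl <;> replace he : V _ ≠ 0 := he <;> tauto
  rintro x ((rfl | rfl) | (rfl | rfl))
  exacts [hall.1, hall.2.1, hall.2.2.1, hall.2.2.2]

end OrientedMatroid

lemma skew_pos_union {n : ℕ} (i j : Fin n) :
    (facet i 1 ∩ facet j (-1)) ∪ (facet i (-1) ∩ facet j 1) = {v : Cube n | v i * v j = -1} := by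
  have : ∀ a b : ℤˣ, (a = 1 ∧ b = -1) ∨ (a = -1 ∧ b = 1) ↔ a * b = -1 := by decide
  ext v
  exact this _ _

lemma skew_neg_union {n : ℕ} (i j : Fin n) :
    (facet i 1 ∩ facet j 1) ∪ (facet i (-1) ∩ facet j (-1)) = {v : Cube n | v i * v j = 1} := by
  have : ∀ a b : ℤˣ, (a = 1 ∧ b = 1) ∨ (a = -1 ∧ b = -1) ↔ a * b = 1 := by decide
  ext v
  exact this _ _

/-- For an oriented cube it suffices that the signed rectangles are vectors and that the prescribed
cocircuits are covectors: minimality of the supports is automatic. -/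
lemma isOrientedCube_of_mem {n : ℕ} {M : OrientedMatroid (Cube n)} (hM : M.RectangleBalanced)
    (hfacet : ∀ i s, signedSet (facet i s) ∅ ∈ M.covectors)
    (hpos : ∀ i j : Fin n, i < j →
      signedSet (facet i 1 ∩ facet j (-1)) (facet i (-1) ∩ facet j 1) ∈ M.covectors)
    (hneg : ∀ i j : Fin n, i < j →
      signedSet (facet i 1 ∩ facet j 1) (facet i (-1) ∩ facet j (-1)) ∈ M.covectors) :
    IsOrientedCube M where
  rectangle _ _ _ _ H := hM.isCircuit_rectangle hfacet H
  facet_pos i := hM.isCocircuit_facet (hfacet i _)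
  facet_neg i := hM.isCocircuit_facet (hfacet i _)
  skew_pos i j hij := hM.isCocircuit_skew hij.ne (skew_pos_union i j) (hpos i j hij)
  skew_neg i j hij := hM.isCocircuit_skew hij.ne (skew_neg_union i j) (hneg i j hij)

namespace IsOrientedCube

lemma rectangleBalanced {n : ℕ} {M : OrientedMatroid (Cube n)} (hM : IsOrientedCube M) :
    M.RectangleBalanced :=
  fun W hW u v u' v' H => (H.signOrthogonal_iff W).1 ((hM.rectangle u v u' v' H).1 W hW)

lemma facet_mem {n : ℕ} {M : OrientedMatroid (Cube n)} (hM : IsOrientedCube M) (i : Fin n)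
    (s : ℤˣ) : signedSet (facet i s) ∅ ∈ M.covectors := by
  rcases Int.units_eq_one_or s with rfl | rfl
  · exact (hM.facet_neg i).1
  · exact (hM.facet_pos i).1

end IsOrientedCube

/-! ### The real oriented cube -/

namespace OrientedMatroid

/-- The oriented matroid of a linear space of real functions: its covectors are the sign vectors
of the functions. -/
def ofSubmodule {E : Type*} [Finite E] (V : Submodule ℝ (E → ℝ)) : OrientedMatroid E where
  covectors := {X | ∃ f ∈ V, X = fun e => SignType.sign (f e)}
  zero_mem := ⟨0, V.zero_mem, by simp⟩
  neg_mem := by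
    rintro _ ⟨f, hf, rfl⟩
    exact ⟨-f, V.neg_mem hf, by ext e; simp [Left.sign_neg]⟩
  comp_mem := by
    rintro _ ⟨f, hf, rfl⟩ _ ⟨k, hk, rfl⟩
    -- The composition is the sign vector of `f + ε • k` for all small `ε > 0`.
    have hev : ∀ᶠ ε : ℝ in nhdsWithin 0 (Set.Ioi 0), ∀ e,
        signComp (fun e => SignType.sign (f e)) (fun e => SignType.sign (k e)) e =
          SignType.sign ((f + ε • k) e) := by
      rw [Filter.eventually_all]
      intro e
      have hlim : Filter.Tendsto (fun ε : ℝ => f e + ε * k e) (nhdsWithin 0 (Set.Ioi 0))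
          (nhds (f e)) := by
        have : Continuous fun ε : ℝ => f e + ε * k e := by fun_prop
        simpa using (this.tendsto 0).mono_left nhdsWithin_le_nhds
      rcases lt_trichotomy (f e) 0 with h | h | h
      · filter_upwards [hlim.eventually (gt_mem_nhds h)] with ε hε
        simp [signComp, sign_neg h, sign_neg hε]
      · filter_upwards [self_mem_nhdsWithin] with ε hε
        simp [signComp, h, sign_mul, sign_pos (show (0 : ℝ) < ε from hε)]
      · filter_upwards [hlim.eventually (lt_mem_nhds h)] with ε hε
        simp [signComp, sign_pos h, sign_pos hε]
    obtain ⟨ε, hε⟩ := hev.exists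
    exact ⟨f + ε • k, V.add_mem hf (V.smul_mem _ hk), funext hε⟩
  elimination := by
    rintro _ ⟨f, hf, rfl⟩ _ ⟨k, hk, rfl⟩ e he hek
    have hf0 : f e ≠ 0 := by simpa using he
    have hk0 : k e ≠ 0 := by
      intro h
      simp [h] at hek
      exact hf0 hek
    refine ⟨_, ⟨|k e| • f + |f e| • k, V.add_mem (V.smul_mem _ hf) (V.smul_mem _ hk), rfl⟩,
      ?_, ?_⟩
    · have hek' : SignType.sign (f e) = SignType.sign (-k e) := hek.trans (Left.sign_neg _).symm
      simp only [Pi.add_apply, Pi.smul_apply, smul_eq_mul, sign_eq_zero_iff]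
      rcases hf0.lt_or_gt with h | h
      · have : k e > 0 := by
          rw [sign_neg h, eq_comm, sign_eq_neg_one_iff] at hek'
          linarith
        rw [abs_of_pos this, abs_of_neg h]
        ring
      · have : k e < 0 := by
          rw [sign_pos h, eq_comm, sign_eq_one_iff] at hek'
          linarith
        rw [abs_of_neg this, abs_of_pos h]
        ring
    · intro x hx
      have hk1 := abs_pos.2 hk0
      have hf1 := abs_pos.2 hf0
      simp only [Pi.add_apply, Pi.smul_apply, smul_eq_mul, signComp]
      rcases lt_trichotomy (f x) 0 with h | h | h
      · have hkx : k x ≤ 0 := by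
          by_contra hc
          exact hx ⟨by simp [h.ne], by simp [sign_neg h, sign_pos (not_le.1 hc)]⟩
        rw [sign_neg h, if_neg (by decide)]
        exact sign_neg (add_neg_of_neg_of_nonpos (mul_neg_of_pos_of_neg hk1 h)
          (mul_nonpos_of_nonneg_of_nonpos hf1.le hkx))
      · simp [h, sign_mul, hf0]
      · have hkx : 0 ≤ k x := by
          by_contra hc
          exact hx ⟨by simp [h.ne'], by simp [sign_pos h, sign_neg (not_le.1 hc)]⟩
        rw [sign_pos h, if_neg (by decide)]
        exact sign_pos (add_pos_of_pos_of_nonneg (mul_pos hk1 h) (mul_nonneg hf1.le hkx))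

end OrientedMatroid

/-- The real functions on the cube that have equal sums on the two diagonals of each rectangle.
They are the restrictions of the affine functions. -/
def rectangleAffine (n : ℕ) : Submodule ℝ (Cube n → ℝ) where
  carrier := {f | ∀ u v u' v', IsRectangle u v u' v' → f u + f v = f u' + f v'}
  add_mem' := by
    intro f k hf hk u v u' v' H
    have h1 := hf _ _ _ _ H
    have h2 := hk _ _ _ _ H
    simp only [Pi.add_apply]
    linarith
  zero_mem' := by
    intro u v u' v' _
    simp
  smul_mem' := by
    intro c f hf u v u' v' H
    have h1 := hf _ _ _ _ H
    simp only [Pi.smul_apply, smul_eq_mul]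
    rw [← mul_add, h1, mul_add]

lemma const_mem_rectangleAffine {n : ℕ} (c : ℝ) : (fun _ => c) ∈ rectangleAffine n :=
  fun _ _ _ _ _ => rfl

lemma coord_mem_rectangleAffine {n : ℕ} (i : Fin n) :
    (fun v : Cube n => (((v i : ℤˣ) : ℤ) : ℝ)) ∈ rectangleAffine n :=
  fun _ _ _ _ H => by
    dsimp only
    exact_mod_cast H.1 i

lemma isOrientedCube_rectangleAffine (n : ℕ) :
    IsOrientedCube (OrientedMatroid.ofSubmodule (rectangleAffine n)) := by
  refine isOrientedCube_of_mem ?_ ?_ ?_ ?_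
  · rintro _ ⟨f, hf, rfl⟩ u v u' v' H
    have h := hf _ _ _ _ H
    simp only [BalancedSigns, sign_eq_one_iff, sign_eq_neg_one_iff]
    constructor <;> intro h' <;> by_contra! hc <;> rcases h' with h' | h' | h' | h' <;> linarith
  · intro i s
    refine ⟨_, (rectangleAffine n).add_mem (const_mem_rectangleAffine 1)
      ((rectangleAffine n).smul_mem ((s : ℤ) : ℝ) (coord_mem_rectangleAffine i)), funext fun v => ?_⟩
    rcases Int.units_eq_one_or (v i) with h | h <;>
      rcases Int.units_eq_one_or s with rfl | rfl <;>
      simp [signedSet, facet, h, show (-1 : ℤˣ) ≠ 1 by decide, show (1 : ℤˣ) ≠ -1 by decide]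
  · intro i j _
    refine ⟨_, (rectangleAffine n).sub_mem (coord_mem_rectangleAffine i)
      (coord_mem_rectangleAffine j), funext fun v => ?_⟩
    rcases Int.units_eq_one_or (v i) with h | h <;>
      rcases Int.units_eq_one_or (v j) with h' | h' <;>
      simp [signedSet, facet, h, h', show (-1 : ℤˣ) ≠ 1 by decide,
        show (1 : ℤˣ) ≠ -1 by decide]
  · intro i j _
    refine ⟨_, (rectangleAffine n).add_mem (coord_mem_rectangleAffine i)
      (coord_mem_rectangleAffine j), funext fun v => ?_⟩
    rcases Int.units_eq_one_or (v i) with h | h <;>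
      rcases Int.units_eq_one_or (v j) with h' | h' <;>
      simp [signedSet, facet, h, h', show (-1 : ℤˣ) ≠ 1 by decide,
        show (1 : ℤˣ) ≠ -1 by decide]

/-- If `b` exceeds the weight, `X_b(h)` is positive everywhere, and an oriented cube of positive
dimension does not have it as a cocircuit. In dimension zero, the oriented matroid
with the zero covector only is an oriented cube without cocircuits. -/
lemma le_weight_of_isCocircuit {n : ℕ} {h : Fin n → ℕ} {b : ℕ}
    (hcocircuit : ∀ M : OrientedMatroid (Cube n), IsOrientedCube M →
      M.IsCocircuit (levelSigned h b)) : b ≤ weight h := by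
  by_contra! hb
  rcases Nat.eq_zero_or_pos n with rfl | hn
  · have hM : IsOrientedCube (OrientedMatroid.ofSubmodule (⊥ : Submodule ℝ (Cube 0 → ℝ))) := by
      refine isOrientedCube_of_mem ?_ (fun i => i.elim0) (fun i => i.elim0) (fun i => i.elim0)
      intro _ _ u v u' v' H
      exact absurd (Subsingleton.elim u u') H.2.2.1
    obtain ⟨⟨f, hf, hX⟩, hX0, -⟩ := hcocircuit _ hM
    refine hX0 (hX.trans ?_)
    rw [(Submodule.mem_bot ℝ).1 hf]
    ext
    simp
  · obtain ⟨-, -, hmin⟩ := hcocircuit _ (isOrientedCube_rectangleAffine n)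
    have hfull : Function.support (levelSigned h b) = Set.univ := by
      ext v
      have := height_le_weight h v
      simp [levelSigned_apply, sub_eq_zero]
      omega
    have hY := (isOrientedCube_rectangleAffine n).facet_pos ⟨0, hn⟩
    have := hmin _ hY.1 hY.2.1 (by rw [hfull]; exact Set.subset_univ _)
    rw [hfull, support_signedSet, Set.union_empty] at this
    have h1 : (fun _ => 1 : Cube n) ∈ facet (⟨0, hn⟩ : Fin n) (-1) := this ▸ Set.mem_univ _
    exact absurd (show (1 : ℤˣ) = -1 from h1) (by decide)

/-! ### Restriction and uniqueness of cocircuits -/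

namespace OrientedMatroid

/-- The oriented matroid on `E'` whose covectors are the compositions of the covectors of `M` with
`ι : E' → E`; for an injection `ι` it is the restriction of `M` to `E'`. -/
def comap {E E' : Type*} [Finite E] [Finite E'] (M : OrientedMatroid E) (ι : E' → E) :
    OrientedMatroid E' where
  covectors := {X | ∃ Y ∈ M.covectors, X = Y ∘ ι}
  zero_mem := ⟨_, M.zero_mem, rfl⟩
  neg_mem := by
    rintro _ ⟨Y, hY, rfl⟩
    exact ⟨_, M.neg_mem Y hY, rfl⟩
  comp_mem := by
    rintro _ ⟨Y, hY, rfl⟩ _ ⟨Y', hY', rfl⟩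
    exact ⟨_, M.comp_mem Y hY Y' hY', rfl⟩
  elimination := by
    rintro _ ⟨Y, hY, rfl⟩ _ ⟨Y', hY', rfl⟩ e he hee
    obtain ⟨Z, hZ, hZe, hZf⟩ := M.elimination Y hY Y' hY' (ι e) he hee
    exact ⟨_, ⟨Z, hZ, rfl⟩, hZe, fun f hf => hZf (ι f) hf⟩

/-- Among the covectors whose support lies in that of a cocircuit, only the cocircuit, its negative
and zero occur. -/
lemma IsCocircuit.eq_or_eq_neg {E : Type*} [Finite E] {M : OrientedMatroid E}
    {X W : E → SignType} (hX : M.IsCocircuit X) (hW : W ∈ M.covectors) (hW0 : W ≠ 0)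
    (hsub : Function.support W ⊆ Function.support X) : W = X ∨ W = fun e => -X e := by
  obtain ⟨hXm, -, hmin⟩ := hX
  -- A sign vector opposite to `W` at one element is opposite everywhere: elimination leaves zero.
  have key : ∀ X' ∈ M.covectors, Function.support X' = Function.support X →
      ∀ e, W e ≠ 0 → W e = -X' e → W = fun e => -X' e := by
    intro X' hX' hsupp e he hee
    obtain ⟨Z, hZ, hZe, hZf⟩ := M.elimination W hW X' hX' e he hee
    have hsame := hmin W hW hW0 hsub
    have hZ0 : Z = 0 := by
      by_contra hne
      have hZsub : Function.support Z ⊆ Function.support X := by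
        intro f hf
        by_contra hfX
        have h1 : W f = 0 := by
          by_contra h
          exact hfX (hsub h)
        have h2 : X' f = 0 := by
          by_contra h
          exact hfX (hsupp ▸ h)
        exact hf ((hZf f (by simp [h1])).trans (by simp [signComp, h1, h2]))
      have : e ∈ Function.support Z := by
        rw [hmin Z hZ hne hZsub]
        exact hsub he
      exact this hZe
    ext1 f
    by_contra hf
    have h1 := hZf f fun h => hf h.2
    rw [hZ0] at h1
    by_cases hWf : W f = 0
    · have h2 : X' f = 0 := by
        by_contra h
        have : f ∈ Function.support W := by
          rw [hsame, ← hsupp]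
          exact h
        exact this hWf
      exact hf (by rw [hWf, h2, neg_zero])
    · rw [signComp, if_neg hWf] at h1
      exact hWf h1.symm
  obtain ⟨e, he⟩ := Function.ne_iff.1 hW0
  replace he : W e ≠ 0 := he
  have aux : ∀ p q : SignType, p ≠ 0 → q ≠ 0 → p = -q ∨ p = - -q := by decide
  rcases aux (W e) (X e) he (hsub he) with h | h
  · exact Or.inr (key X hXm rfl e he h)
  · left
    have := key _ (M.neg_mem X hXm) (by ext; simp) e he h
    simpa using this

end OrientedMatroid

/-- The restriction of an oriented cube to the facet of last coordinate `1` is an oriented cube. -/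
lemma IsOrientedCube.comap_snoc {n : ℕ} {M : OrientedMatroid (Cube (n + 1))}
    (hM : IsOrientedCube M) :
    IsOrientedCube (M.comap fun v : Cube n => Cube.snoc v 1) := by
  refine isOrientedCube_of_mem ?_ (fun i s => ?_) (fun i j hij => ?_) fun i j hij => ?_
  · rintro _ ⟨Y, hY, rfl⟩ u v u' v' H
    exact hM.rectangleBalanced Y hY _ _ _ _ (H.snoc (Or.inl ⟨rfl, rfl⟩))
  · refine ⟨_, hM.facet_mem i.castSucc s, funext fun v => ?_⟩
    simp [signedSet, facet, Cube.snoc]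
  · refine ⟨_, (hM.skew_pos i.castSucc j.castSucc hij).1, funext fun v => ?_⟩
    simp [signedSet, facet, Cube.snoc]
  · refine ⟨_, (hM.skew_neg i.castSucc j.castSucc hij).1, funext fun v => ?_⟩
    simp [signedSet, facet, Cube.snoc]

/-! ### Extension of cocircuits -/

/-- Rectangles determine a covector of the `(n + 1)`-cube that extends `X_b(h)` from the facet
`x (n + 1) = 1` and vanishes at one vertex of the `b`-level outside this facet. -/
lemma eq_levelSigned_appendEntry {n : ℕ} {h : Fin n → ℕ} (hprim : IsPrimitive h) {b g : ℕ}
    (hlink : LevelsLinked h b) (hb : b ≤ weight h) (hg : g ≤ b)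
    {M : OrientedMatroid (Cube (n + 1))} (hM : M.RectangleBalanced)
    {W : Cube (n + 1) → SignType} (hW : W ∈ M.covectors)
    (hres : ∀ v : Cube n, W (v.snoc 1) = levelSigned h b v) {p : Cube n}
    (hp : height h p + g = b) (hWp : W (p.snoc (-1)) = 0) :
    W = levelSigned (appendEntry h g) b := by
  have hres0 : ∀ v : Cube n, height h v = b → W (v.snoc 1) = 0 := fun v hv => by
    rw [hres, levelSigned_apply, hv, sub_self, sign_zero]
  have hneg0 : ∀ v : Cube n, height h v + g = b → W (v.snoc (-1)) = 0 := by
    intro v hv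
    rw [← hWp]
    by_cases hvp : v = p
    · rw [hvp]
    by_cases h0 : height h p = b
    · exact (hM W hW _ _ _ _ (isRectangle_prism hvp (by decide))).eq_of_zero
        (hres0 p h0) (hres0 v (by omega))
    · refine eq_of_sideGraph_reachable (A := level h (height h p)) (B := level h b)
        (f := fun x : Cube n => W (x.snoc (-1))) ?_
        (hlink _ h0 ⟨v, mem_level.2 (by omega)⟩ ⟨p, mem_level.2 rfl⟩)
      intro u x u' x' H hx hx'
      exact (hM W hW _ _ _ _ (H.snoc (s := -1) (t := 1) (s' := -1) (t' := 1)
        (Or.inl ⟨rfl, rfl⟩))).eq_of_zero (hres0 x (mem_level.1 hx)) (hres0 x' (mem_level.1 hx'))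
  have hzero : ∀ w, height (appendEntry h g) w = b → W w = 0 := by
    intro w hw
    obtain ⟨v, s, rfl⟩ := Cube.exists_snoc w
    rcases Int.units_eq_one_or s with rfl | rfl
    · exact hres0 v (by rwa [height_snoc_one] at hw)
    · exact hneg0 v (by rwa [height_snoc_neg_one] at hw)
  have hlink' := hlink.appendEntry hprim hb hg
  have hconst : ∀ w w', height (appendEntry h g) w = height (appendEntry h g) w' →
      height (appendEntry h g) w ≠ b → W w = W w' := by
    intro w w' hww hwb
    refine eq_of_sideGraph_reachable (f := W) ?_
      (hlink' _ hwb ⟨w, mem_level.2 rfl⟩ ⟨w', mem_level.2 hww.symm⟩)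
    intro u x u' x' H hx hx'
    exact (hM W hW _ _ _ _ H).eq_of_zero (hzero x (mem_level.1 hx)) (hzero x' (mem_level.1 hx'))
  have main : ∀ a w, height (appendEntry h g) w = a → W w = SignType.sign ((b : ℤ) - a) := by
    intro a
    induction a using Nat.strong_induction_on with
    | _ a ih =>
      intro w hw
      by_cases hab : a = b
      · rw [hzero w (hw.trans hab), hab, sub_self, sign_zero]
      by_cases ha : a ≤ weight h
      · obtain ⟨v, hv⟩ := hprim.exists_height_eq ha
        rw [hconst w (v.snoc 1) (by rw [height_snoc_one, hw, hv]) (hw ▸ hab), hres,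
          levelSigned_apply, hv]
      have hwt := height_le_weight (appendEntry h g) w
      rw [weight_appendEntry] at hwt
      -- A rectangle with heights `b - 1`, `a` on one diagonal and `b`, `a - 1` on the other: the
      -- signs at the first three vertices `x`, `y`, `z` force a negative sign at `d`.
      have hrect : ∃ x y z d : Cube n, height h x = b - 1 ∧ height h y = b ∧
          height h z = a - 1 - g ∧ height h d = a - g ∧
          IsRectangle (x.snoc 1) (d.snoc (-1)) (y.snoc 1) (z.snoc (-1)) := by
        by_cases hpq : b - 1 = a - 1 - g
        · obtain ⟨x, hx⟩ := hprim.exists_height_eq (a := b - 1) (by omega)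
          obtain ⟨y, hy⟩ := hprim.exists_height_eq hb
          refine ⟨x, y, x, y, hx, hy, by omega, by omega, isRectangle_prism ?_ (by decide)⟩
          rintro rfl
          omega
        · obtain ⟨x, y, z, d, hx, hy, hz, hd, H⟩ :=
            hprim.exists_isRectangle (p := b - 1) (q := a - 1 - g) (δ := 1) one_pos hpq
              (by omega) (by omega)
          exact ⟨x, y, z, d, hx, by omega, hz, by omega, H.snoc (Or.inl ⟨rfl, rfl⟩)⟩
      obtain ⟨x, y, z, d, hx, hy, hz, hd, H⟩ := hrect
      have hbal := hM W hW _ _ _ _ H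
      rw [hres0 y hy, hres x, levelSigned_apply, hx, sign_pos (by omega)] at hbal
      have hWz := ih (a - 1) (by omega) (z.snoc (-1)) (by rw [height_snoc_neg_one]; omega)
      have hz1 : W (z.snoc (-1)) ≠ 1 := by
        rw [hWz, Ne, sign_eq_one_iff]
        omega
      have aux : ∀ q s : SignType, BalancedSigns 1 q 0 s → s ≠ 1 → q = -1 := by decide
      rw [hconst w (d.snoc (-1)) (by rw [height_snoc_neg_one]; omega) (hw ▸ hab),
        aux _ _ hbal hz1, sign_neg (by omega)]
  ext1 w
  rw [main _ w rfl, levelSigned_apply]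

lemma levelSigned_appendEntry_snoc {n : ℕ} (h : Fin n → ℕ) (g b : ℕ) (v : Cube n) :
    levelSigned (appendEntry h g) b (v.snoc 1) = levelSigned h b v := by
  rw [levelSigned_apply, levelSigned_apply, height_snoc_one]

lemma isCocircuit_levelSigned_appendEntry {n : ℕ} {h : Fin n → ℕ} (hprim : IsPrimitive h)
    {b g : ℕ} (hlink : LevelsLinked h b) (hb : b ≤ weight h) (hg : g ≤ b)
    {M : OrientedMatroid (Cube (n + 1))} (hM : IsOrientedCube M)
    (hX : (M.comap fun v : Cube n => Cube.snoc v 1).IsCocircuit (levelSigned h b)) :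
    M.IsCocircuit (levelSigned (appendEntry h g) b) := by
  obtain ⟨p, hp⟩ := hprim.exists_height_eq (a := b - g) (by omega)
  have hp' : height h p + g = b := by omega
  have unique : ∀ W ∈ M.covectors, (∀ v : Cube n, W (v.snoc 1) = levelSigned h b v) →
      W (p.snoc (-1)) = 0 → W = levelSigned (appendEntry h g) b := fun W hW hres hWp =>
    eq_levelSigned_appendEntry hprim hlink hb hg hM.rectangleBalanced hW hres hp' hWp
  have hY := hM.facet_pos (Fin.last n)
  set Y := signedSet (facet (Fin.last n) (-1)) ∅ with hYdef
  have hYp : Y (p.snoc (-1)) = 1 := by simp [hYdef, signedSet, facet, Cube.snoc]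
  have hY1 : ∀ v : Cube n, Y (v.snoc 1) = 0 := fun v => by
    simp [hYdef, signedSet, facet, Cube.snoc, show (1 : ℤˣ) ≠ -1 by decide]
  -- Eliminating the facet cocircuit `± Y` does not change an extension of `X_b(h)` on the facet.
  have hmem : levelSigned (appendEntry h g) b ∈ M.covectors := by
    obtain ⟨X₀, hX₀, hX₀r⟩ := hX.1
    have hr : ∀ v : Cube n, X₀ (v.snoc 1) = levelSigned h b v := fun v =>
      (congrFun hX₀r v).symm
    by_cases h0 : X₀ (p.snoc (-1)) = 0
    · exact unique X₀ hX₀ hr h0 ▸ hX₀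
    have elim : ∀ Y' ∈ M.covectors, (∀ v : Cube n, Y' (v.snoc 1) = 0) →
        X₀ (p.snoc (-1)) = -Y' (p.snoc (-1)) →
        levelSigned (appendEntry h g) b ∈ M.covectors := by
      intro Y' hY' hY'1 hsep
      obtain ⟨Z, hZ, hZp, hZf⟩ := M.elimination X₀ hX₀ Y' hY' _ h0 hsep
      refine unique Z hZ (fun v => ?_) hZp ▸ hZ
      rw [hZf _ (by simp [hY'1]), ← hr]
      by_cases hv : X₀ (v.snoc 1) = 0 <;> simp [signComp, hv, hY'1]
    have aux : ∀ s : SignType, s ≠ 0 → s = -1 ∨ s = - -1 := by decide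
    rcases aux _ h0 with hs | hs
    · exact elim Y hY.1 hY1 (by rw [hs, hYp])
    · exact elim _ (M.neg_mem Y hY.1) (fun v => by simp [hY1]) (by rw [hs, hYp])
  refine ⟨hmem, fun hzero => hX.2.1 ?_, fun W hW hW0 hsub => ?_⟩
  · ext1 v
    rw [← levelSigned_appendEntry_snoc h g, hzero]
    rfl
  have hXp : levelSigned (appendEntry h g) b (p.snoc (-1)) = 0 := by
    rw [levelSigned_apply, height_snoc_neg_one, hp', sub_self, sign_zero]
  have hWp : W (p.snoc (-1)) = 0 := by
    by_contra hne
    exact hsub hne hXp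
  by_cases hres0 : (W ∘ fun v : Cube n => v.snoc 1) = 0
  · -- A covector that vanishes on the facet and at `p` has smaller support than the facet cocircuit.
    exfalso
    have hWY : Function.support W ⊆ Function.support Y := by
      intro w hw
      obtain ⟨v, s, rfl⟩ := Cube.exists_snoc w
      rcases Int.units_eq_one_or s with rfl | rfl
      · exact absurd (congrFun hres0 v) hw
      · simp [hYdef, signedSet, facet, Cube.snoc]
    have : p.snoc (-1) ∈ Function.support W := by
      rw [hY.2.2 W hW hW0 hWY]
      simp [hYp]
    exact this hWp
  · have hcases := hX.eq_or_eq_neg ⟨W, hW, rfl⟩ hres0 fun v hv => by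
      rw [Function.mem_support, ← levelSigned_appendEntry_snoc h g]
      exact hsub hv
    rcases hcases with hc | hc
    · rw [unique W hW (fun v => congrFun hc v) hWp]
    · have := unique _ (M.neg_mem W hW)
        (fun v => by simpa using congrArg (fun s => -s) (congrFun hc v)) (by simp [hWp])
      rw [← this]
      ext
      simp

theorem mainTheorem3 {n : ℕ} (h : Fin n → ℕ) (hprim : IsPrimitive h) (b : ℕ)
    (hembed : ∀ a : ℕ, 0 < a → a < weight h → a ≠ b → Embeds (level h a) (level h b))
    (hcocircuit : ∀ M : OrientedMatroid (Cube n), IsOrientedCube M →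
      M.IsCocircuit (levelSigned h b))
    (g : ℕ) (hg : g ≤ b) :
    (∀ a : ℕ, 0 < a → a < weight (appendEntry h g) → a ≠ b →
      Embeds (level (appendEntry h g) a) (level (appendEntry h g) b)) ∧
    (∀ M : OrientedMatroid (Cube (n + 1)), IsOrientedCube M →
      M.IsCocircuit (levelSigned (appendEntry h g) b)) ∧
    (∀ v : Cube n,
      levelSigned (appendEntry h g) b (Fin.snoc (α := fun _ => ℤˣ) v 1) = levelSigned h b v) := by
  have hb := le_weight_of_isCocircuit hcocircuit
  have hlink := levelsLinked_of_embeds hprim hb hembed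
  refine ⟨fun a _ ha hab => embeds_iff.2 ?_, fun M hM => ?_, levelSigned_appendEntry_snoc h g b⟩
  · rw [weight_appendEntry] at ha
    have hne : Nonempty (level (appendEntry h g) a) := by
      rcases le_or_gt a (weight h) with hle | hlt
      · obtain ⟨v, hv⟩ := hprim.exists_height_eq hle
        exact ⟨v.snoc 1, mem_level.2 (by rw [height_snoc_one, hv])⟩
      · obtain ⟨v, hv⟩ := hprim.exists_height_eq (a := a - g) (by omega)
        exact ⟨v.snoc (-1), mem_level.2 (by rw [height_snoc_neg_one]; omega)⟩
    exact ⟨hlink.appendEntry hprim hb hg a hab⟩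
  · exact isCocircuit_levelSigned_appendEntry hprim hlink hb hg hM (hcocircuit _ hM.comap_snoc)
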